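/- Let $\alpha,\beta,\rho,\bar u,x_0>0$ be real numbers with $(\beta-\rho x_0)\bar u-\alpha x_0>0$. For $t_f>0$ consider the problem of minimising $$J(u)=\int_0^{t_f}|u(t)|\,dt$$ over all measurable controls $u:[0,t_f]\to[0,\bar u]$ for which the solution $x$ (in the Carathéodory sense, i.e. $x$ is continuous and $x(t)=x(0)+\int_0^t(-\alpha x+\beta u-\rho xu)\,d\tau$ for all $t\in[0,t_f]$) of $$\dot x(t)=-\alpha x(t)+\beta u(t)-\rho x(t)u(t),\qquad x(0)=x_0,$$ satisfies $x(t_f)=x_0$. Then, for every $t_f>0$: 1. The equation $$x_0=e^{(-\alpha-\rho\bar u)(t_f-s)}\left(x_0e^{-\alpha s}-\frac{\beta\bar u}{\alpha+\rho\bar u}\right)+\frac{\beta\bar u}{\alpha+\rho\bar u}$$ has exactly one real solution $s=t_{sw}=t_{sw}(t_f)$, and $t_{sw}\in(0,t_f)$. 2. The control $$u^*(t)=\begin{cases}0,& t\in[0,t_{sw}),\\ \bar u,& t\in[t_{sw},t_f],\end{cases}$$ is a minimiser, and it is the unique one: every minimiser equals $u^*$ almost everywhere on $[0,t_f]$. 3.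 The function $t_f\mapsto t_{sw}(t_f)$ is differentiable on $(0,\infty)$ and $$\frac{dt_{sw}}{dt_f}=1+\frac{\alpha x_0}{\bigl(\rho x_0-\beta e^{\alpha t_{sw}}\bigr)\bar u}.$$ -/

import Mathlib

namespace Furnace

/-- An admissible control on `[0, tf]`: Lebesgue measurable with values in `[0, ubar]`. -/
def IsControl (ubar tf : ℝ) (u : ℝ → ℝ) : Prop :=
  AEMeasurable u (MeasureTheory.volume.restrict (Set.Icc 0 tf)) ∧
    ∀ t ∈ Set.Icc 0 tf, u t ∈ Set.Icc 0 ubar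

/-- `x` is a Carathéodory solution on `[0, tf]` of `x' = -α x + β u - ρ x u`:
a continuous function satisfying the integral equation. -/
def IsTrajectory (α β ρ tf : ℝ) (u x : ℝ → ℝ) : Prop :=
  ContinuousOn x (Set.Icc 0 tf) ∧
    ∀ t ∈ Set.Icc 0 tf,
      x t = x 0 + ∫ τ in (0 : ℝ)..t, (-α * x τ + β * u τ - ρ * x τ * u τ)

/-- The control `u` is admissible and steers the system from `x₀` at time `0`
to `x₀` at time `tf`. -/
def IsFeasible (α β ρ ubar x₀ tf : ℝ) (u : ℝ → ℝ) : Prop :=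
  IsControl ubar tf u ∧
    ∃ x : ℝ → ℝ, IsTrajectory α β ρ tf u x ∧ x 0 = x₀ ∧ x tf = x₀

/-- The performance index (consumed energy). -/
noncomputable def cost (tf : ℝ) (u : ℝ → ℝ) : ℝ := ∫ t in (0 : ℝ)..tf, |u t|

/-- `u` solves the optimal control problem. -/
def IsOptimal (α β ρ ubar x₀ tf : ℝ) (u : ℝ → ℝ) : Prop :=
  IsFeasible α β ρ ubar x₀ tf u ∧
    ∀ v : ℝ → ℝ, IsFeasible α β ρ ubar x₀ tf v → cost tf u ≤ cost tf v

/-- The control that is `0` before time `s` and `ubar` from time `s` on. -/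
noncomputable def bangBang (ubar s : ℝ) : ℝ → ℝ := fun t => if t < s then 0 else ubar

/-- The equation for the switching time `s` belonging to the terminal time `tf`. -/
def SwitchingEq (α β ρ ubar x₀ tf s : ℝ) : Prop :=
  x₀ = Real.exp ((-α - ρ * ubar) * (tf - s)) *
      (x₀ * Real.exp (-α * s) - β * ubar / (α + ρ * ubar)) + β * ubar / (α + ρ * ubar)

end Furnace

/-
Let `W t` be the fuel `∫ u` that a control still has to spend after time `t`. Burning an amount `w`
of fuel instantaneously moves the state along the flow of `dx/dw = β - ρ x`. The quantity
`exp (α t)` times the state that would be reached by burning all of `W t` at once has derivative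
`α β exp (α t) P (W t)`, where `P w = ∫ r in 0..w, exp (-ρ r)` is increasing. Since both endpoints
of the trajectory are `x₀`, this gives the balance

  `(exp (α tf) - 1) x₀ = (β - ρ x₀) P (W 0) + α β ∫ t in 0..tf, exp (α t) P (W t)`,

whose right-hand side is increasing in `W`. A bang-bang control burns its fuel as late as possible,
so its `W` dominates that of every control that is at most as expensive; the balance then forces
equality.

The switching time is the instant at which the free decay starting from `x₀` at time `0` meets the
full-power trajectory that ends in `x₀` at time `tf`. The former is decreasing and the latter is
increasing, so they meet exactly once.
-/

namespace Furnace

open MeasureTheory Set Filter Topology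

/-! ### Affine flows on the line -/

/-- The primitive of `t ↦ exp (c * t)` that vanishes at `0`. Written as an integral, it equals
`(exp (c * t) - 1) / c` for `c ≠ 0` and `t` for `c = 0`. -/
noncomputable def expPrimitive (c t : ℝ) : ℝ := ∫ r in (0 : ℝ)..t, Real.exp (c * r)

/-- The solution at time `t` of `y' = b - a * y`, `y 0 = x`. It serves for the motion under constant
power and, with fuel in place of time, for the effect of an instantaneous burst. -/
noncomputable def affineFlow (a b x t : ℝ) : ℝ := x + (b - a * x) * expPrimitive (-a) t

section AffineFlow

variable {a b c t x : ℝ}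

lemma expPrimitive_zero : expPrimitive c 0 = 0 := intervalIntegral.integral_same

lemma hasStrictDerivAt_expPrimitive : HasStrictDerivAt (expPrimitive c) (Real.exp (c * t)) t :=
  Continuous.integral_hasStrictDerivAt (by fun_prop) 0 t

lemma contDiff_expPrimitive : ContDiff ℝ 1 (expPrimitive c) := by
  have hderiv : deriv (expPrimitive c) = fun t => Real.exp (c * t) :=
    funext fun _ => hasStrictDerivAt_expPrimitive.hasDerivAt.deriv
  rw [contDiff_one_iff_deriv, hderiv]
  exact ⟨fun _ => hasStrictDerivAt_expPrimitive.hasDerivAt.differentiableAt, by fun_prop⟩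

lemma strictMono_expPrimitive : StrictMono (expPrimitive c) :=
  strictMono_of_hasDerivAt_pos (fun _ => hasStrictDerivAt_expPrimitive.hasDerivAt)
    fun _ => Real.exp_pos _

lemma exp_eq_one_add_mul_expPrimitive : Real.exp (c * t) = 1 + c * expPrimitive c t := by
  have hderiv : ∀ r ∈ uIcc 0 t, HasDerivAt (fun r => Real.exp (c * r)) (c * Real.exp (c * r)) r :=
    fun r _ => ((hasDerivAt_const_mul c).exp).congr_deriv (mul_comm _ _)
  have hint := intervalIntegral.integral_eq_sub_of_hasDerivAt hderiv
    (Continuous.intervalIntegrable (by fun_prop) _ _)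
  rw [intervalIntegral.integral_const_mul, mul_zero, Real.exp_zero] at hint
  rw [expPrimitive, hint]
  ring

lemma affineFlow_zero : affineFlow a b x 0 = x := by
  rw [affineFlow, expPrimitive_zero, mul_zero, add_zero]

lemma sub_mul_affineFlow : b - a * affineFlow a b x t = (b - a * x) * Real.exp (-a * t) := by
  rw [exp_eq_one_add_mul_expPrimitive, affineFlow]
  ring

lemma affineFlow_zero_right : affineFlow a 0 x t = x * Real.exp (-a * t) := by
  rw [exp_eq_one_add_mul_expPrimitive, affineFlow]
  ring

lemma affineFlow_eq_exp (ha : a ≠ 0) :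
    affineFlow a b x t = Real.exp (-a * t) * (x - b / a) + b / a := by
  rw [exp_eq_one_add_mul_expPrimitive, affineFlow]
  field_simp
  ring

lemma hasStrictDerivAt_affineFlow :
    HasStrictDerivAt (affineFlow a b x) (b - a * affineFlow a b x t) t := by
  rw [sub_mul_affineFlow]
  exact (hasStrictDerivAt_expPrimitive.const_mul (b - a * x)).const_add x

lemma continuous_affineFlow : Continuous (affineFlow a b x) :=
  continuous_iff_continuousAt.2 fun _ => hasStrictDerivAt_affineFlow.hasDerivAt.continuousAt

lemma strictMono_affineFlow (h : a * x < b) : StrictMono (affineFlow a b x) :=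
  (strictMono_expPrimitive.const_mul (sub_pos.2 h)).const_add x

lemma strictAnti_affineFlow (h : b < a * x) : StrictAnti (affineFlow a b x) :=
  (strictMono_expPrimitive.const_mul_of_neg (sub_neg.2 h)).const_add x

end AffineFlow

/-! ### Curves meeting at a delay -/

lemma exists_forall_eq_comp_sub_iff {f g : ℝ → ℝ} {t : ℝ} (hf : StrictAnti f) (hg : StrictMono g)
    (hfc : Continuous f) (hgc : Continuous g) (h0 : f 0 = g 0) (ht : 0 < t) :
    ∃ s ∈ Ioo 0 t, ∀ r, f r = g (r - t) ↔ r = s := by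
  have hmono : StrictMono fun r => g (r - t) - f r := fun r₁ r₂ h =>
    sub_lt_sub (hg (sub_lt_sub_right h t)) (hf h)
  have hleft : g (0 - t) - f 0 < 0 := by
    rw [h0, sub_neg]
    exact hg (by linarith)
  have hright : 0 < g (t - t) - f t := by
    rw [sub_self, ← h0, sub_pos]
    exact hf ht
  obtain ⟨s, hs, hs0⟩ := intermediate_value_Ioo ht.le
    (f := fun r => g (r - t) - f r) (by fun_prop) ⟨hleft, hright⟩
  refine ⟨s, hs, fun r => ?_⟩
  calc f r = g (r - t) ↔ g (r - t) - f r = 0 := by rw [sub_eq_zero, eq_comm]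
    _ ↔ r = s := hs0 ▸ hmono.injective.eq_iff

-- Near `τ t₀` the equation can be solved for `t`, and `τ` is a left inverse of that solution.
lemma hasDerivAt_of_eq_comp_sub_iff {f g τ : ℝ → ℝ} {f' g' t₀ : ℝ}
    (hf : HasStrictDerivAt f f' (τ t₀)) (hg : HasStrictDerivAt g g' (τ t₀ - t₀)) (hg' : g' ≠ 0)
    (hfg : g' - f' ≠ 0) (hτ : ∀ᶠ t in 𝓝 t₀, ∀ s, f s = g (s - t) ↔ s = τ t) :
    HasDerivAt τ (g' / (g' - f')) t₀ := by
  have heq : f (τ t₀) = g (τ t₀ - t₀) := (hτ.self_of_nhds _).2 rfl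
  set gInv := hg.localInverse g g' _ hg'
  set T : ℝ → ℝ := fun s => s - gInv (f s)
  have hTt₀ : T (τ t₀) = t₀ := by
    have : gInv (g (τ t₀ - t₀)) = τ t₀ - t₀ :=
      (hg.hasStrictFDerivAt_equiv hg').localInverse_apply_image
    change τ t₀ - gInv (f (τ t₀)) = t₀
    rw [heq, this, sub_sub_cancel]
  have hgInv : HasStrictDerivAt gInv g'⁻¹ (f (τ t₀)) := heq ▸ hg.to_localInverse hg'
  have hTd : HasStrictDerivAt T (1 - g'⁻¹ * f') (τ t₀) :=
    (hasStrictDerivAt_id _).sub (hgInv.comp _ hf)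
  have hT' : 1 - g'⁻¹ * f' = (g' - f') / g' := by field_simp
  have hinv : ∀ᶠ s in 𝓝 (τ t₀), τ (T s) = s := by
    have hgr : ∀ᶠ y in 𝓝 (f (τ t₀)), g (gInv y) = y :=
      heq ▸ hg.eventually_right_inverse hg'
    filter_upwards [hf.hasDerivAt.continuousAt.eventually hgr,
      hTd.hasDerivAt.continuousAt.eventually (hTt₀.symm ▸ hτ)] with s hs hτs
    refine ((hτs s).1 ?_).symm
    change f s = g (s - (s - gInv (f s)))
    rw [sub_sub_cancel, hs]
  have hτd := hTd.to_local_left_inverse (hT' ▸ div_ne_zero hfg hg') hinv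
  rw [hTt₀, hT', inv_div] at hτd
  exact hτd.hasDerivAt

/-! ### The balance of fuel -/

/-- The fuel `∫ u` that the control `u` spends between time `t` and the terminal time `tf`. -/
noncomputable def fuelToGo (tf : ℝ) (u : ℝ → ℝ) (t : ℝ) : ℝ := ∫ r in t..tf, u r

variable {α β ρ ubar x₀ tf s t : ℝ} {u v x : ℝ → ℝ}

lemma fuelToGo_self : fuelToGo tf u tf = 0 := intervalIntegral.integral_same

lemma fuelToGo_eq_neg_integral : fuelToGo tf u = fun t => -∫ r in tf..t, u r :=
  funext fun t => intervalIntegral.integral_symm tf t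

lemma absolutelyContinuousOnInterval_fuelToGo (hu : IntervalIntegrable u volume 0 tf) :
    AbsolutelyContinuousOnInterval (fuelToGo tf u) 0 tf := by
  rw [fuelToGo_eq_neg_integral]
  exact (hu.absolutelyContinuousOnInterval_intervalIntegral right_mem_uIcc).fun_neg

lemma ae_hasDerivAt_fuelToGo (hu : IntervalIntegrable u volume 0 tf) :
    ∀ᵐ t, t ∈ uIcc 0 tf → HasDerivAt (fuelToGo tf u) (-u t) t := by
  rw [fuelToGo_eq_neg_integral]
  filter_upwards [hu.ae_hasDerivAt_integral] with t h ht
  exact (h ht tf right_mem_uIcc).fun_neg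

lemma ae_eq_of_eqOn_fuelToGo (hu : IntervalIntegrable u volume 0 tf)
    (hv : IntervalIntegrable v volume 0 tf)
    (h : EqOn (fuelToGo tf u) (fuelToGo tf v) (Icc 0 tf)) :
    ∀ᵐ t ∂volume.restrict (Icc 0 tf), u t = v t := by
  rw [← restrict_Ioo_eq_restrict_Icc, ae_restrict_iff' measurableSet_Ioo]
  filter_upwards [ae_hasDerivAt_fuelToGo hu, ae_hasDerivAt_fuelToGo hv] with t hut hvt ht
  have ht' : t ∈ uIcc 0 tf := Icc_subset_uIcc (Ioo_subset_Icc_self ht)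
  have heq : fuelToGo tf u =ᶠ[𝓝 t] fuelToGo tf v :=
    h.eventuallyEq_of_mem (Icc_mem_nhds ht.1 ht.2)
  exact neg_injective ((hut ht').unique ((hvt ht').congr_of_eventuallyEq heq))

lemma absolutelyContinuousOnInterval_comp {f g : ℝ → ℝ} {a b : ℝ} (hg : ContDiff ℝ 1 g)
    (hf : AbsolutelyContinuousOnInterval f a b) :
    AbsolutelyContinuousOnInterval (fun t => g (f t)) a b := by
  obtain ⟨C, hC⟩ := hf.exists_bound
  have hmaps : MapsTo f (uIcc a b) (Metric.closedBall 0 C) := fun t ht =>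
    mem_closedBall_zero_iff.2 (hC t ht)
  obtain ⟨K, hK⟩ := hg.contDiffOn.exists_lipschitzOnWith one_ne_zero
    (convex_closedBall (0 : ℝ) C) (isCompact_closedBall 0 C)
  have hlim := Tendsto.const_mul (K : ℝ) hf
  rw [mul_zero] at hlim
  refine squeeze_zero' (.of_forall fun _ => Finset.sum_nonneg fun _ _ => dist_nonneg) ?_ hlim
  filter_upwards [mem_inf_of_right (mem_principal_self _)] with E hE
  rw [Finset.mul_sum]
  exact Finset.sum_le_sum fun i hi =>
    hK.dist_le_mul _ (hmaps (hE.1 i hi).1) _ (hmaps (hE.1 i hi).2)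

lemma absolutelyContinuousOnInterval_exp_mul_affineFlow {w : ℝ → ℝ} {a b : ℝ}
    (hx : AbsolutelyContinuousOnInterval x a b) (hw : AbsolutelyContinuousOnInterval w a b) :
    AbsolutelyContinuousOnInterval
      (fun t => Real.exp (α * t) * affineFlow ρ β (x t) (w t)) a b := by
  have hexp : AbsolutelyContinuousOnInterval (fun t => Real.exp (α * t)) a b :=
    ContDiffOn.absolutelyContinuousOnInterval (by fun_prop)
  have hβ : AbsolutelyContinuousOnInterval (fun _ => β) a b :=
    contDiffOn_const.absolutelyContinuousOnInterval
  exact hexp.fun_mul (hx.fun_add ((hβ.fun_sub (hx.const_mul ρ)).fun_mul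
    (absolutelyContinuousOnInterval_comp contDiff_expPrimitive hw)))

lemma hasDerivAt_exp_mul_affineFlow {w : ℝ → ℝ} {p : ℝ}
    (hx : HasDerivAt x (-α * x t + β * p - ρ * x t * p) t) (hw : HasDerivAt w (-p) t) :
    HasDerivAt (fun t => Real.exp (α * t) * affineFlow ρ β (x t) (w t))
      (α * β * (Real.exp (α * t) * expPrimitive (-ρ) (w t))) t := by
  have hP : HasDerivAt (fun t => expPrimitive (-ρ) (w t)) (Real.exp (-ρ * w t) * -p) t :=
    hasStrictDerivAt_expPrimitive.hasDerivAt.comp t hw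
  refine ((hasDerivAt_const_mul α).exp.fun_mul
    (hx.fun_add (((hx.const_mul ρ).const_sub β).fun_mul hP))).congr_deriv ?_
  rw [exp_eq_one_add_mul_expPrimitive (c := -ρ)]
  ring

lemma IsTrajectory.integral_exp_mul_expPrimitive (htf : 0 ≤ tf)
    (hu : IntervalIntegrable u volume 0 tf) (hx : IsTrajectory α β ρ tf u x) :
    α * β * ∫ t in (0 : ℝ)..tf, Real.exp (α * t) * expPrimitive (-ρ) (fuelToGo tf u t) =
      Real.exp (α * tf) * x tf - affineFlow ρ β (x 0) (fuelToGo tf u 0) := by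
  have hIcc : uIcc 0 tf = Icc 0 tf := uIcc_of_le htf
  have hxc : ContinuousOn x (uIcc 0 tf) := hIcc ▸ hx.1
  set f : ℝ → ℝ := fun τ => -α * x τ + β * u τ - ρ * x τ * u τ
  have hf : IntervalIntegrable f volume 0 tf :=
    ((hxc.const_smul (-α)).intervalIntegrable.add (hu.const_mul β)).sub
      (hu.continuousOn_mul (hxc.const_smul ρ))
  -- `x` is constrained on `[0, tf]` only; `X` extends it to be differentiable at the endpoints too.
  set X : ℝ → ℝ := fun t => x 0 + ∫ τ in (0 : ℝ)..t, f τ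
  have hX : ∀ t ∈ uIcc 0 tf, X t = x t := fun t ht => (hx.2 t (hIcc ▸ ht)).symm
  have hXac : AbsolutelyContinuousOnInterval X 0 tf :=
    AbsolutelyContinuousOnInterval.fun_add contDiffOn_const.absolutelyContinuousOnInterval
      (hf.absolutelyContinuousOnInterval_intervalIntegral left_mem_uIcc)
  have hFTC := (absolutelyContinuousOnInterval_exp_mul_affineFlow (α := α) (β := β) (ρ := ρ) hXac
    (absolutelyContinuousOnInterval_fuelToGo hu)).integral_deriv_eq_sub
  rw [hX 0 left_mem_uIcc, hX tf right_mem_uIcc, fuelToGo_self, affineFlow_zero, mul_zero,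
    Real.exp_zero, one_mul] at hFTC
  rw [← hFTC, ← intervalIntegral.integral_const_mul]
  refine intervalIntegral.integral_congr_ae ?_
  filter_upwards [hf.ae_hasDerivAt_integral, ae_hasDerivAt_fuelToGo hu] with t hft hut ht
  have ht' := uIoc_subset_uIcc ht
  have hXt : HasDerivAt X (-α * X t + β * u t - ρ * X t * u t) t :=
    hX t ht' ▸ (hft ht' 0 left_mem_uIcc).const_add (x 0)
  exact (hasDerivAt_exp_mul_affineFlow hXt (hut ht')).deriv.symm

/-! ### Comparison of controls -/

lemma IsControl.intervalIntegrable (hu : IsControl ubar tf u) (htf : 0 ≤ tf) :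
    IntervalIntegrable u volume 0 tf := by
  rw [intervalIntegrable_iff_integrableOn_Icc_of_le htf]
  refine Integrable.of_bound hu.1.aestronglyMeasurable ubar ?_
  filter_upwards [ae_restrict_mem measurableSet_Icc] with t ht
  rw [Real.norm_of_nonneg (hu.2 t ht).1]
  exact (hu.2 t ht).2

lemma IsControl.cost_eq_fuelToGo (hu : IsControl ubar tf u) (htf : 0 ≤ tf) :
    cost tf u = fuelToGo tf u 0 := by
  refine intervalIntegral.integral_congr fun t ht => ?_
  exact abs_of_nonneg (hu.2 t (uIcc_of_le htf ▸ ht)).1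

lemma IsFeasible.balance (htf : 0 ≤ tf) (hu : IsFeasible α β ρ ubar x₀ tf u) :
    (Real.exp (α * tf) - 1) * x₀ = (β - ρ * x₀) * expPrimitive (-ρ) (fuelToGo tf u 0) +
      α * β * ∫ t in (0 : ℝ)..tf, Real.exp (α * t) * expPrimitive (-ρ) (fuelToGo tf u t) := by
  obtain ⟨hc, x, hx, h0, h1⟩ := hu
  rw [hx.integral_exp_mul_expPrimitive htf (hc.intervalIntegrable htf), h0, h1, affineFlow]
  ring

lemma continuousOn_exp_mul_expPrimitive_fuelToGo {c : ℝ} (htf : 0 ≤ tf)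
    (hu : IntervalIntegrable u volume 0 tf) :
    ContinuousOn (fun t => Real.exp (α * t) * expPrimitive c (fuelToGo tf u t)) (Icc 0 tf) := by
  have hW := (absolutelyContinuousOnInterval_fuelToGo hu).continuousOn
  rw [uIcc_of_le htf] at hW
  exact (Continuous.continuousOn (by fun_prop)).mul
    (contDiff_expPrimitive.continuous.comp_continuousOn hW)

lemma IsFeasible.eqOn_fuelToGo_of_le (hα : 0 < α) (hβ : 0 < β) (hx₀ : ρ * x₀ ≤ β) (htf : 0 < tf)
    (hu : IsFeasible α β ρ ubar x₀ tf u) (hv : IsFeasible α β ρ ubar x₀ tf v)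
    (hle : ∀ t ∈ Icc 0 tf, fuelToGo tf u t ≤ fuelToGo tf v t) :
    EqOn (fuelToGo tf u) (fuelToGo tf v) (Icc 0 tf) := by
  intro t ht
  by_contra hne
  have hP : StrictMono (expPrimitive (-ρ)) := strictMono_expPrimitive
  have hint : ∫ t in (0 : ℝ)..tf, Real.exp (α * t) * expPrimitive (-ρ) (fuelToGo tf u t) <
      ∫ t in (0 : ℝ)..tf, Real.exp (α * t) * expPrimitive (-ρ) (fuelToGo tf v t) := by
    refine intervalIntegral.integral_lt_integral_of_continuousOn_of_le_of_exists_lt htf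
      (continuousOn_exp_mul_expPrimitive_fuelToGo htf.le (hu.1.intervalIntegrable htf.le))
      (continuousOn_exp_mul_expPrimitive_fuelToGo htf.le (hv.1.intervalIntegrable htf.le))
      (fun r hr => ?_) ⟨t, ht, ?_⟩
    · exact mul_le_mul_of_nonneg_left (hP.monotone (hle r (Ioc_subset_Icc_self hr)))
        (Real.exp_pos _).le
    · exact mul_lt_mul_of_pos_left (hP ((hle t ht).lt_of_ne hne)) (Real.exp_pos _)
  have hstart : (β - ρ * x₀) * expPrimitive (-ρ) (fuelToGo tf u 0) ≤
      (β - ρ * x₀) * expPrimitive (-ρ) (fuelToGo tf v 0) :=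
    mul_le_mul_of_nonneg_left (hP.monotone (hle 0 ⟨le_rfl, htf.le⟩)) (sub_nonneg.2 hx₀)
  linarith [hu.balance htf.le, hv.balance htf.le, mul_lt_mul_of_pos_left hint (mul_pos hα hβ)]

/-! ### Bang-bang controls -/

lemma bangBang_of_lt (h : t < s) : bangBang ubar s t = 0 := if_pos h

lemma bangBang_of_le (h : s ≤ t) : bangBang ubar s t = ubar := if_neg h.not_gt

lemma isControl_bangBang (hubar : 0 ≤ ubar) : IsControl ubar tf (bangBang ubar s) := by
  refine ⟨(Measurable.ite measurableSet_Iio measurable_const measurable_const).aemeasurable,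
    fun t _ => ?_⟩
  rcases lt_or_ge t s with h | h
  · rw [bangBang_of_lt h]
    exact left_mem_Icc.2 hubar
  · rw [bangBang_of_le h]
    exact right_mem_Icc.2 hubar

lemma IsControl.fuelToGo_le_fuelToGo_bangBang (hu : IsControl ubar tf u)
    (hle : cost tf u ≤ cost tf (bangBang ubar s)) (ht : t ∈ Icc 0 tf) :
    fuelToGo tf u t ≤ fuelToGo tf (bangBang ubar s) t := by
  have htf : 0 ≤ tf := ht.1.trans ht.2
  have hb : IsControl ubar tf (bangBang ubar s) :=
    isControl_bangBang ((hu.2 t ht).1.trans (hu.2 t ht).2)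
  have ht' : t ∈ uIcc 0 tf := Icc_subset_uIcc ht
  have hui := hu.intervalIntegrable htf
  have hbi := hb.intervalIntegrable htf
  have hui₀ : IntervalIntegrable u volume 0 t := hui.mono_set (uIcc_subset_uIcc_left ht')
  have hbi₀ : IntervalIntegrable (bangBang ubar s) volume 0 t :=
    hbi.mono_set (uIcc_subset_uIcc_left ht')
  have hui₁ : IntervalIntegrable u volume t tf := hui.mono_set (uIcc_subset_uIcc_right ht')
  have hbi₁ : IntervalIntegrable (bangBang ubar s) volume t tf :=
    hbi.mono_set (uIcc_subset_uIcc_right ht')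
  rcases lt_or_ge t s with hts | hst
  · have hspent : ∫ r in (0 : ℝ)..t, bangBang ubar s r ≤ ∫ r in (0 : ℝ)..t, u r :=
      intervalIntegral.integral_mono_on ht.1 hbi₀ hui₀ fun r hr =>
        (bangBang_of_lt (hr.2.trans_lt hts)).trans_le (hu.2 r ⟨hr.1, hr.2.trans ht.2⟩).1
    rw [hu.cost_eq_fuelToGo htf, hb.cost_eq_fuelToGo htf, fuelToGo, fuelToGo,
      ← intervalIntegral.integral_add_adjacent_intervals hui₀ hui₁,
      ← intervalIntegral.integral_add_adjacent_intervals hbi₀ hbi₁] at hle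
    rw [fuelToGo, fuelToGo]
    linarith
  · exact intervalIntegral.integral_mono_on ht.2 hui₁ hbi₁ fun r hr =>
      (hu.2 r ⟨ht.1.trans hr.1, hr.2⟩).2.trans_eq (bangBang_of_le (hst.trans hr.1)).symm

lemma IsFeasible.eqOn_fuelToGo_bangBang (hα : 0 < α) (hβ : 0 < β) (hx₀ : ρ * x₀ ≤ β)
    (htf : 0 < tf) (hu : IsFeasible α β ρ ubar x₀ tf u)
    (hb : IsFeasible α β ρ ubar x₀ tf (bangBang ubar s))
    (hle : cost tf u ≤ cost tf (bangBang ubar s)) :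
    EqOn (fuelToGo tf u) (fuelToGo tf (bangBang ubar s)) (Icc 0 tf) :=
  hu.eqOn_fuelToGo_of_le hα hβ hx₀ htf hb fun _ ht => hu.1.fuelToGo_le_fuelToGo_bangBang hle ht

lemma isOptimal_bangBang (hα : 0 < α) (hβ : 0 < β) (hx₀ : ρ * x₀ ≤ β) (htf : 0 < tf)
    (hb : IsFeasible α β ρ ubar x₀ tf (bangBang ubar s)) :
    IsOptimal α β ρ ubar x₀ tf (bangBang ubar s) := by
  refine ⟨hb, fun v hv => ?_⟩
  rcases le_total (cost tf v) (cost tf (bangBang ubar s)) with hle | hle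
  · rw [hv.1.cost_eq_fuelToGo htf.le, hb.1.cost_eq_fuelToGo htf.le]
    exact (hv.eqOn_fuelToGo_bangBang hα hβ hx₀ htf hb hle ⟨le_rfl, htf.le⟩).ge
  · exact hle

lemma IsOptimal.ae_eq_bangBang (hα : 0 < α) (hβ : 0 < β) (hx₀ : ρ * x₀ ≤ β) (htf : 0 < tf)
    (hu : IsOptimal α β ρ ubar x₀ tf u)
    (hb : IsFeasible α β ρ ubar x₀ tf (bangBang ubar s)) :
    ∀ᵐ t ∂volume.restrict (Icc 0 tf), u t = bangBang ubar s t :=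
  ae_eq_of_eqOn_fuelToGo (hu.1.1.intervalIntegrable htf.le) (hb.1.intervalIntegrable htf.le)
    (hu.1.eqOn_fuelToGo_bangBang hα hβ hx₀ htf hb (hu.2 _ hb))

/-! ### The switching time -/

lemma switchingEq_iff_affineFlow_eq (hA : α + ρ * ubar ≠ 0) :
    SwitchingEq α β ρ ubar x₀ tf s ↔
      affineFlow α 0 x₀ s = affineFlow (α + ρ * ubar) (β * ubar) x₀ (s - tf) := by
  have hexp : Real.exp ((-α - ρ * ubar) * (tf - s)) *
      Real.exp (-(α + ρ * ubar) * (s - tf)) = 1 := by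
    rw [← Real.exp_add, Real.exp_eq_one_iff]
    ring
  rw [SwitchingEq, affineFlow_zero_right, affineFlow_eq_exp hA]
  set E := Real.exp ((-α - ρ * ubar) * (tf - s))
  set E' := Real.exp (-(α + ρ * ubar) * (s - tf))
  set k := β * ubar / (α + ρ * ubar)
  constructor <;> intro h
  · linear_combination (x₀ * Real.exp (-α * s) - k) * -hexp - E' * h
  · linear_combination (x₀ - k) * -hexp - E * h

/-- The state under `bangBang ubar s` that starts and ends in `x₀`: free decay up to time `s`, then
the full-power trajectory ending in `x₀` at time `tf`. -/
noncomputable def bangBangTrajectory (α β ρ ubar x₀ tf s t : ℝ) : ℝ :=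
  if t ≤ s then affineFlow α 0 x₀ t else affineFlow (α + ρ * ubar) (β * ubar) x₀ (t - tf)

lemma continuous_bangBangTrajectory
    (h : affineFlow α 0 x₀ s = affineFlow (α + ρ * ubar) (β * ubar) x₀ (s - tf)) :
    Continuous (bangBangTrajectory α β ρ ubar x₀ tf s) :=
  Continuous.if_le continuous_affineFlow
    (continuous_affineFlow.comp (continuous_id.sub continuous_const)) continuous_id
    continuous_const fun _ ht => ht ▸ h

lemma hasDerivAt_bangBangTrajectory (ht : t ≠ s) :
    HasDerivAt (bangBangTrajectory α β ρ ubar x₀ tf s)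
      (-α * bangBangTrajectory α β ρ ubar x₀ tf s t + β * bangBang ubar s t -
        ρ * bangBangTrajectory α β ρ ubar x₀ tf s t * bangBang ubar s t) t := by
  rcases ht.lt_or_gt with h | h
  · have heq : bangBangTrajectory α β ρ ubar x₀ tf s =ᶠ[𝓝 t] affineFlow α 0 x₀ := by
      filter_upwards [Iio_mem_nhds h] with r hr
      exact if_pos (le_of_lt hr)
    refine (hasStrictDerivAt_affineFlow.hasDerivAt.congr_of_eventuallyEq heq).congr_deriv ?_
    rw [heq.eq_of_nhds, bangBang_of_lt h]
    ring
  · have heq : bangBangTrajectory α β ρ ubar x₀ tf s =ᶠ[𝓝 t]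
        fun r => affineFlow (α + ρ * ubar) (β * ubar) x₀ (r - tf) := by
      filter_upwards [Ioi_mem_nhds h] with r hr
      exact if_neg (not_le_of_gt hr)
    refine ((hasStrictDerivAt_affineFlow.hasDerivAt.comp_sub_const t tf).congr_of_eventuallyEq
      heq).congr_deriv ?_
    rw [heq.eq_of_nhds, bangBang_of_le h.le]
    ring

lemma isTrajectory_bangBangTrajectory (hubar : 0 ≤ ubar)
    (h : affineFlow α 0 x₀ s = affineFlow (α + ρ * ubar) (β * ubar) x₀ (s - tf)) :
    IsTrajectory α β ρ tf (bangBang ubar s) (bangBangTrajectory α β ρ ubar x₀ tf s) := by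
  have hc := continuous_bangBangTrajectory h
  refine ⟨hc.continuousOn, fun t ht => ?_⟩
  have hi := (isControl_bangBang (s := s) (tf := t) hubar).intervalIntegrable ht.1
  rw [integral_eq_of_hasDerivAt_off_countable_of_le _ _ ht.1 (countable_singleton s)
    hc.continuousOn fun r hr => hasDerivAt_bangBangTrajectory hr.2]
  · exact (add_sub_cancel _ _).symm
  · exact (((hc.intervalIntegrable _ _).const_mul _).add (hi.const_mul _)).sub
      (hi.continuousOn_mul (hc.const_smul ρ).continuousOn)

lemma isFeasible_bangBang (hubar : 0 ≤ ubar) (hs : s ∈ Ico 0 tf)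
    (h : affineFlow α 0 x₀ s = affineFlow (α + ρ * ubar) (β * ubar) x₀ (s - tf)) :
    IsFeasible α β ρ ubar x₀ tf (bangBang ubar s) := by
  refine ⟨isControl_bangBang hubar, _, isTrajectory_bangBangTrajectory hubar h, ?_, ?_⟩
  · rw [bangBangTrajectory, if_pos hs.1, affineFlow_zero]
  · rw [bangBangTrajectory, if_neg hs.2.not_ge, sub_self, affineFlow_zero]

lemma exists_forall_switchingEq_iff (hα : 0 < α) (hx₀ : 0 < x₀) (hA : α + ρ * ubar ≠ 0)
    (hass : 0 < (β - ρ * x₀) * ubar - α * x₀) (htf : 0 < tf) :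
    ∃ s ∈ Ioo 0 tf, ∀ r, SwitchingEq α β ρ ubar x₀ tf r ↔ r = s := by
  simp only [switchingEq_iff_affineFlow_eq hA]
  exact exists_forall_eq_comp_sub_iff (strictAnti_affineFlow (mul_pos hα hx₀))
    (strictMono_affineFlow (by linarith)) continuous_affineFlow continuous_affineFlow
    (by rw [affineFlow_zero, affineFlow_zero]) htf

lemma hasDerivAt_switchingTime {tsw : ℝ → ℝ} (hα : 0 < α) (hx₀ : 0 < x₀)
    (hA : α + ρ * ubar ≠ 0) (hass : 0 < (β - ρ * x₀) * ubar - α * x₀)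
    (htsw : ∀ᶠ t in 𝓝 tf, ∀ s, SwitchingEq α β ρ ubar x₀ t s ↔ s = tsw t) :
    HasDerivAt tsw (1 + α * x₀ / ((ρ * x₀ - β * Real.exp (α * tsw tf)) * ubar)) tf := by
  simp only [switchingEq_iff_affineFlow_eq hA] at htsw
  have hmeet := (htsw.self_of_nhds _).2 rfl
  have hfull : 0 < β * ubar - (α + ρ * ubar) *
      affineFlow (α + ρ * ubar) (β * ubar) x₀ (tsw tf - tf) := by
    rw [sub_mul_affineFlow]
    exact mul_pos (by linarith) (Real.exp_pos _)
  have hdecay : affineFlow α 0 x₀ (tsw tf) * Real.exp (α * tsw tf) = x₀ := by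
    rw [affineFlow_zero_right, mul_assoc, ← Real.exp_add, neg_mul, neg_add_cancel, Real.exp_zero,
      mul_one]
  have hE : 0 < Real.exp (α * tsw tf) := Real.exp_pos _
  have hy : 0 < affineFlow α 0 x₀ (tsw tf) := pos_of_mul_pos_left (hx₀.trans_eq hdecay.symm) hE.le
  have hαy := mul_pos hα hy
  refine (hasDerivAt_of_eq_comp_sub_iff hasStrictDerivAt_affineFlow hasStrictDerivAt_affineFlow
    hfull.ne' (by linarith) htsw).congr_deriv ?_
  rw [← hmeet] at hfull ⊢
  set y := affineFlow α 0 x₀ (tsw tf)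
  set E := Real.exp (α * tsw tf)
  have hgap : 0 < (β - ρ * y) * ubar := by linarith
  have hden : (ρ * x₀ - β * E) * ubar = -((β - ρ * y) * ubar) * E := by
    linear_combination -ρ * ubar * hdecay
  have hslope : β * ubar - (α + ρ * ubar) * y - (0 - α * y) = (β - ρ * y) * ubar := by ring
  rw [hden, hslope, ← hdecay, ← mul_assoc, mul_div_mul_right _ _ hE.ne', div_neg, ← sub_eq_add_neg,
    one_sub_div hgap.ne']
  ring

end Furnace

theorem theorem2_general (α β ρ ubar x₀ : ℝ) (hα : 0 < α) (hβ : 0 < β)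
    (hubar : 0 < ubar) (hx₀ : 0 < x₀) (hA : α + ρ * ubar ≠ 0)
    (hass : 0 < (β - ρ * x₀) * ubar - α * x₀) :
    ∃ tsw : ℝ → ℝ, ∀ tf : ℝ, 0 < tf →
      tsw tf ∈ Set.Ioo 0 tf ∧
      Furnace.IsOptimal α β ρ ubar x₀ tf (Furnace.bangBang ubar (tsw tf)) ∧
      (∀ u : ℝ → ℝ, Furnace.IsOptimal α β ρ ubar x₀ tf u →
        ∀ᵐ t ∂(MeasureTheory.volume.restrict (Set.Icc 0 tf)),
          u t = Furnace.bangBang ubar (tsw tf) t) ∧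
      (∀ s : ℝ, Furnace.SwitchingEq α β ρ ubar x₀ tf s ↔ s = tsw tf) ∧
      HasDerivAt tsw
        (1 + α * x₀ / ((ρ * x₀ - β * Real.exp (α * tsw tf)) * ubar)) tf := by
  have hρx₀ : ρ * x₀ ≤ β :=
    (sub_pos.1 (pos_of_mul_pos_left (by nlinarith [mul_pos hα hx₀]) hubar.le)).le
  choose! tsw hmem htsw using fun tf htf =>
    Furnace.exists_forall_switchingEq_iff (tf := tf) hα hx₀ hA hass htf
  refine ⟨tsw, fun tf htf => ?_⟩
  have hmeet := (Furnace.switchingEq_iff_affineFlow_eq hA).1 ((htsw tf htf _).2 rfl)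
  have hfeas := Furnace.isFeasible_bangBang hubar.le (Set.Ioo_subset_Ico_self (hmem tf htf)) hmeet
  exact ⟨hmem tf htf, Furnace.isOptimal_bangBang hα hβ hρx₀ htf hfeas,
    fun u hu => hu.ae_eq_bangBang hα hβ hρx₀ htf hfeas, htsw tf htf,
    Furnace.hasDerivAt_switchingTime hα hx₀ hA hass ((eventually_gt_nhds htf).mono htsw)⟩

theorem theorem2 (α β ρ ubar x₀ : ℝ) (hα : 0 < α) (hβ : 0 < β) (hρ : 0 < ρ)
    (hubar : 0 < ubar) (hx₀ : 0 < x₀) (hass : 0 < (β - ρ * x₀) * ubar - α * x₀) :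
    ∃ tsw : ℝ → ℝ, ∀ tf : ℝ, 0 < tf →
      tsw tf ∈ Set.Ioo 0 tf ∧
      Furnace.IsOptimal α β ρ ubar x₀ tf (Furnace.bangBang ubar (tsw tf)) ∧
      (∀ u : ℝ → ℝ, Furnace.IsOptimal α β ρ ubar x₀ tf u →
        ∀ᵐ t ∂(MeasureTheory.volume.restrict (Set.Icc 0 tf)),
          u t = Furnace.bangBang ubar (tsw tf) t) ∧
      (∀ s : ℝ, Furnace.SwitchingEq α β ρ ubar x₀ tf s ↔ s = tsw tf) ∧
      HasDerivAt tsw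
        (1 + α * x₀ / ((ρ * x₀ - β * Real.exp (α * tsw tf)) * ubar)) tf :=
  theorem2_general α β ρ ubar x₀ hα hβ hubar hx₀ (by positivity) hass
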